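/- Let $w=w_0w_1w_2\dots$ be a Sturmian word, that is, a right-infinite word over a finite alphabet which, for every $n\ge 0$, has exactly $n+1$ distinct factors of length $n$. For a factor $u$ of $w$ let $n_1<n_2<n_3<\dots$ be all the positions $n_i$ for which $w_{n_i}w_{n_i+1}\dots w_{n_i+|u|-1}$ is abelian equivalent to $u$ (two finite words are abelian equivalent if they are permutations of each other). An abelian return to $u$ in $w$ is the abelian equivalence class of a word $w_{n_i}w_{n_i+1}\dots w_{n_{i+1}-1}$ with $i\ge 1$. Then every factor $u$ of $w$ has exactly two or exactly three (distinct) abelian returns in $w$. -/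

import Mathlib

namespace InfiniteWord

variable {A : Type*}

/-- The block `w i, w (i+1), …, w (i+n-1)` of length `n` starting at position `i` of the
right-infinite word `w`. -/
def block (w : ℕ → A) (i n : ℕ) : List A :=
  (List.range n).map fun k => w (i + k)

/-- The finite word `u` is a factor of the right-infinite word `w`. -/
def IsFactor (w : ℕ → A) (u : List A) : Prop :=
  ∃ i, block w i u.length = u

/-- The factor complexity function: the number of distinct factors of length `n`. -/
noncomputable def complexity (w : ℕ → A) (n : ℕ) : ℕ :=
  {u : List A | IsFactor w u ∧ u.length = n}.ncard

/-- A word is Sturmian if it has exactly `n + 1` factors of length `n`, for every `n ≥ 0`. -/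
def IsSturmian (w : ℕ → A) : Prop :=
  ∀ n, complexity w n = n + 1

/-- Two finite words are abelian equivalent if they are permutations of each other. -/
def AbelianEquiv (u v : List A) : Prop :=
  u.Perm v

/-- At position `i` of `w` there starts a block abelian equivalent to `u`. -/
def AbelianOccursAt (w : ℕ → A) (u : List A) (i : ℕ) : Prop :=
  AbelianEquiv (block w i u.length) u

/-- The semi-abelian returns to (the abelian class of) `u` in `w`: the words
`w i … w (j-1)` where `i < j` are consecutive positions at which a block
abelian equivalent to `u` starts. -/
def semiAbelianReturns (w : ℕ → A) (u : List A) : Set (List A) :=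
  {r | ∃ i j, i < j ∧ AbelianOccursAt w u i ∧ AbelianOccursAt w u j ∧
    (∀ k, i < k → k < j → ¬ AbelianOccursAt w u k) ∧ r = block w i (j - i)}

/-- The abelian class of a finite word. Mathlib's `Multiset A` is by definition the quotient of
`List A` by the relation of being permutations of each other. -/
def abelianClass (u : List A) : Multiset A :=
  (u : Multiset A)

/-- Equality of abelian classes is abelian equivalence. -/
theorem abelianClass_eq_iff (u v : List A) : abelianClass u = abelianClass v ↔ AbelianEquiv u v :=
  Multiset.coe_eq_coe

/-- The abelian returns to `u` in `w`: the abelian classes of the semi-abelian returns. -/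
def abelianReturns (w : ℕ → A) (u : List A) : Set (Multiset A) :=
  abelianClass '' semiAbelianReturns w u

end InfiniteWord

namespace InfiniteWord

/-! A Sturmian word codes an irrational rotation. Let `S` count one letter in prefixes and let `a`
be its frequency. The points `y i = i * a - S i` differ pairwise by less than 1, so they form an
orbit of the rotation by `a` on a circle of length 1, cut open. Displacements over a fixed time `n >
0` are nonzero, lie in (-1, 1) and agree mod 1; hence their sign fixes the letter count, and with it
the abelian class of the block. The occurrences of a nonempty class therefore form an initial or
final segment of the orbit ordered by `y`.

The three gap argument (`three_gaps_lower`) applies to such a segment. If `p` and `q` are the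
shortest times of a rise and of a fall inside it, every return takes time `p`, `q` or `p + q`, with
a fixed displacement in each case. Time and displacement determine the abelian return, so there are
at most three. A single one would move every occurrence by the same nonzero displacement, and the
bounded orbit would drift away.

The rotation comes from the complexity: uniqueness of right special factors and aperiodicity give
balance, balance gives a slope, and aperiodicity makes it irrational. -/

/-- The blocks of length `n` of `w` at the positions `i` and `j` coincide. -/
def Agree {A : Type*} (w : ℕ → A) (i j n : ℕ) : Prop :=
  ∀ k < n, w (i + k) = w (j + k)

/-! ### Right special factors, aperiodicity and balance. -/

section Factors

variable {A : Type*} {w : ℕ → A}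

theorem Agree.symm {i j n : ℕ} (h : Agree w i j n) : Agree w j i n :=
  fun k hk => (h k hk).symm

theorem Agree.trans {i j l n : ℕ} (h : Agree w i j n) (h' : Agree w j l n) : Agree w i l n :=
  fun k hk => (h k hk).trans (h' k hk)

theorem Agree.of_succ_left {i j n : ℕ} (h0 : w i = w j) (h : Agree w (i + 1) (j + 1) n) :
    Agree w i j (n + 1) := by
  intro k hk
  rcases k with _ | k
  · simpa using h0
  · have := h k (by omega)
    rwa [show i + 1 + k = i + (k + 1) by omega, show j + 1 + k = j + (k + 1) by omega] at this

theorem Agree.tail {i j n : ℕ} (h : Agree w i j (n + 1)) : Agree w (i + 1) (j + 1) n := by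
  intro k hk
  have := h (k + 1) (by omega)
  rwa [show i + 1 + k = i + (k + 1) by omega, show j + 1 + k = j + (k + 1) by omega]

theorem length_block (w : ℕ → A) (i n : ℕ) : (block w i n).length = n := by
  simp [block]

theorem block_eq_iff {i j n : ℕ} : block w i n = block w j n ↔ Agree w i j n := by
  simp [block, Agree, List.map_inj_left]

theorem block_succ (w : ℕ → A) (i n : ℕ) : block w i (n + 1) = block w i n ++ [w (i + n)] := by
  simp [block, List.range_succ]

theorem take_block_succ (w : ℕ → A) (i n : ℕ) : (block w i (n + 1)).take n = block w i n := by
  rw [block_succ, List.take_append_of_le_length (length_block w i n).ge, List.take_of_length_le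
    (length_block w i n).le]

theorem setOf_isFactor_eq_range (w : ℕ → A) (n : ℕ) :
    {u : List A | IsFactor w u ∧ u.length = n} = Set.range fun i => block w i n := by
  ext u
  constructor
  · rintro ⟨⟨i, hi⟩, rfl⟩
    exact ⟨i, hi⟩
  · rintro ⟨i, rfl⟩
    exact ⟨⟨i, by rw [length_block]⟩, length_block w i n⟩

theorem IsSturmian.ncard_range_block (hw : IsSturmian w) (n : ℕ) :
    (Set.range fun i => block w i n).ncard = n + 1 := by
  rw [← setOf_isFactor_eq_range]
  exact hw n

theorem IsSturmian.finite_range_block (hw : IsSturmian w) (n : ℕ) :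
    (Set.range fun i => block w i n).Finite :=
  Set.finite_of_ncard_pos (by rw [hw.ncard_range_block]; omega)

/-- A Sturmian word has at most one right special factor of each length. -/
theorem IsSturmian.agree_of_rightSpecial (hw : IsSturmian w) {i i' j j' n : ℕ}
    (hi : Agree w i i' n) (hi' : w (i + n) ≠ w (i' + n))
    (hj : Agree w j j' n) (hj' : w (j + n) ≠ w (j' + n)) : Agree w i j n := by
  by_contra hij
  have hlast : ∀ {a b : ℕ}, w (a + n) ≠ w (b + n) → block w b (n + 1) ≠ block w a (n + 1) :=
    fun h h' => h ((block_eq_iff.1 h') n (by omega)).symm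
  have hinit : ∀ {a b : ℕ}, ¬ Agree w a b n → block w a (n + 1) ≠ block w b (n + 1) :=
    fun h h' => h fun k hk => (block_eq_iff.1 h') k (by omega)
  set F := Set.range fun i => block w i (n + 1) with hF
  -- Dropping one extension of each of the two right special factors leaves n blocks, whose
  -- truncations still give all n + 1 factors of length n.
  set G := F \ {block w i (n + 1), block w j (n + 1)} with hG
  have hGfin : G.Finite := (hw.finite_range_block (n + 1)).sdiff
  have hcard : G.ncard = n := by
    rw [hG, Set.ncard_sdiff, hF, hw.ncard_range_block, Set.ncard_pair (hinit hij)]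
    · omega
    · rintro _ (rfl | rfl)
      exacts [⟨i, rfl⟩, ⟨j, rfl⟩]
  have hsub : (Set.range fun i => block w i n) ⊆ List.take n '' G := by
    rintro _ ⟨l, rfl⟩
    by_cases h1 : block w l (n + 1) = block w i (n + 1)
    · refine ⟨block w i' (n + 1), ⟨⟨i', rfl⟩, ?_⟩, ?_⟩
      · rintro (h | h)
        · exact hlast hi' h
        · exact hinit (fun h' => hij (hi.trans h')) h
      · simp only
        rw [← take_block_succ w l, h1, take_block_succ, take_block_succ]
        exact block_eq_iff.2 hi.symm
    by_cases h2 : block w l (n + 1) = block w j (n + 1)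
    · refine ⟨block w j' (n + 1), ⟨⟨j', rfl⟩, ?_⟩, ?_⟩
      · rintro (h | h)
        · exact hinit (fun h' => hij (hj.trans h').symm) h
        · exact hlast hj' h
      · simp only
        rw [← take_block_succ w l, h2, take_block_succ, take_block_succ]
        exact block_eq_iff.2 hj.symm
    · exact ⟨block w l (n + 1), ⟨⟨l, rfl⟩, by rintro (h | h); exacts [h1 h, h2 h]⟩,
        take_block_succ w l n⟩
  have h1 := Set.ncard_le_ncard hsub (hGfin.image _)
  have h2 := Set.ncard_image_le (f := List.take n) hGfin
  rw [hw.ncard_range_block] at h1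
  omega

theorem IsSturmian.exists_agree_of_card (hw : IsSturmian w) {n : ℕ} (T : Finset ℕ)
    (hT : n + 2 ≤ T.card) : ∃ s ∈ T, ∃ t ∈ T, s ≠ t ∧ Agree w s t n := by
  have hfin := hw.finite_range_block n
  obtain ⟨s, hs, t, ht, hne, h⟩ := Finset.exists_ne_map_eq_of_card_lt_of_maps_to
    (s := T) (t := hfin.toFinset) (f := fun i => block w i n)
    (by rw [← Set.ncard_eq_toFinset_card _ hfin, hw.ncard_range_block]; omega)
    (fun i _ => by simp)
  exact ⟨s, hs, t, ht, hne, block_eq_iff.1 h⟩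

/-- Every block of length N + p would also start at some position below N + p, leaving one factor
too few. -/
theorem IsSturmian.not_eventually_periodic (hw : IsSturmian w) {N p : ℕ} (hp : 0 < p)
    (h : ∀ k, N ≤ k → w k = w (k + p)) : False := by
  have key : ∀ i, ∃ j < N + p, Agree w i j (N + p) := by
    intro i
    induction i using Nat.strong_induction_on with
    | _ i ih =>
      by_cases hi : i < N + p
      · exact ⟨i, hi, fun _ _ => rfl⟩
      · obtain ⟨j, hj, hA⟩ := ih (i - p) (by omega)
        refine ⟨j, hj, fun k hk => ?_⟩
        rw [← hA k hk, h (i - p + k) (by omega)]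
        congr 1
        omega
  have hsub : (Set.range fun i => block w i (N + p)) ⊆
      (fun i => block w i (N + p)) '' (Finset.range (N + p) : Set ℕ) := by
    rintro _ ⟨i, rfl⟩
    obtain ⟨j, hj, hA⟩ := key i
    exact ⟨j, by simpa using hj, block_eq_iff.2 hA.symm⟩
  have h1 := Set.ncard_le_ncard hsub ((Finset.finite_toSet _).image _)
  have h2 := Set.ncard_image_le (f := fun i => block w i (N + p))
    (Finset.finite_toSet (Finset.range (N + p)))
  rw [hw.ncard_range_block] at h1
  rw [Set.ncard_coe_finset, Finset.card_range] at h2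
  omega

theorem IsSturmian.exists_ne (hw : IsSturmian w) : ∃ b, w b ≠ w 0 := by
  by_contra! h
  exact hw.not_eventually_periodic (N := 0) one_pos fun k _ => by rw [h k, h (k + 1)]

theorem IsSturmian.eq_of_ne (hw : IsSturmian w) {i j k : ℕ} (hij : w i ≠ w j)
    (hik : w i ≠ w k) : w j = w k := by
  by_contra hjk
  obtain ⟨s, hs, t, ht, hne, h⟩ := hw.exists_agree_of_card (n := 1) {i, j, k} (by
    rw [Finset.card_eq_three.2 ⟨i, j, k, ?_, ?_, ?_, rfl⟩] <;> (rintro rfl; simp_all))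
  have h0 : w s = w t := h 0 one_pos
  simp only [Finset.mem_insert, Finset.mem_singleton] at hs ht
  rcases hs with rfl | rfl | rfl <;> rcases ht with rfl | rfl | rfl <;> simp_all

/-- If `x v x` and `y v y` are factors of a Sturmian word, where `v` is a palindrome and `x ≠ y`
are letters, then `x v` is followed by `y` somewhere. -/
theorem IsSturmian.exists_extension_ne (hw : IsSturmian w) {i j m : ℕ} (hij : w i ≠ w j)
    (hi : w (i + m + 1) = w i) (hj : w (j + m + 1) = w j) (hv : Agree w (i + 1) (j + 1) m)
    (hpal : ∀ k, 1 ≤ k → k ≤ m → w (i + k) = w (i + (m + 1 - k))) :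
    ∃ l, Agree w i l (m + 1) ∧ w (i + (m + 1)) ≠ w (l + (m + 1)) := by
  by_contra! hno
  have hno' : ∀ l, w l = w i → Agree w (l + 1) (i + 1) m → w (l + (m + 1)) = w i := by
    intro l h0 h1
    rw [← hno l (Agree.of_succ_left h0 h1).symm, ← hi, add_assoc]
  -- If `y v` began at `i + t`, inside `x v x`, the palindrome would equate its first letter with
  -- the final `x`.
  have hwin : ∀ t ≤ m + 1, ¬ Agree w (i + t) j (m + 1) := by
    intro t ht h
    have h0 : w (i + t) = w j := h 0 (by omega)
    rcases Nat.eq_zero_or_pos t with rfl | htpos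
    · exact hij h0
    rcases eq_or_lt_of_le ht with rfl | htlt
    · exact hij (by rw [← h0, ← hi, add_assoc])
    · have h1 := h (m + 1 - t) (by omega)
      have h2 := hv (m + 1 - t - 1) (by omega)
      have h3 := hpal t htpos (by omega)
      rw [show i + t + (m + 1 - t) = i + m + 1 by omega, hi] at h1
      rw [show i + 1 + (m + 1 - t - 1) = i + (m + 1 - t) by omega,
        show j + 1 + (m + 1 - t - 1) = j + (m + 1 - t) by omega] at h2
      exact hij (by rw [h1, ← h2, ← h3, h0])
  have hjmem : j ∉ Finset.Icc i (i + m + 1) := by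
    intro h
    rw [Finset.mem_Icc] at h
    refine hwin (j - i) (by omega) fun k _ => ?_
    rw [show i + (j - i) = j by omega]
  -- The m + 2 starts within `x v x`, together with `j`, outnumber the m + 2 factors of length m +
  -- 1, and `j` matches none of them.
  obtain ⟨s, t, hst, his, hti, hA⟩ :
      ∃ s t, s < t ∧ i ≤ s ∧ t ≤ i + m + 1 ∧ Agree w s t (m + 1) := by
    obtain ⟨s, hs, t, ht, hne, h⟩ := hw.exists_agree_of_card (n := m + 1)
      (insert j (Finset.Icc i (i + m + 1)))
      (by rw [Finset.card_insert_of_notMem hjmem, Nat.card_Icc]; omega)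
    rw [Finset.mem_insert, Finset.mem_Icc] at hs ht
    have haux : ∀ r, i ≤ r ∧ r ≤ i + m + 1 → ¬ Agree w r j (m + 1) := fun r hr => by
      have := hwin (r - i) (by omega)
      rwa [show i + (r - i) = r by omega] at this
    rcases hs with rfl | hs
    · rcases ht with rfl | ht
      · exact absurd rfl hne
      · exact absurd h.symm (haux t ht)
    · rcases ht with rfl | ht
      · exact absurd h (haux s hs)
      · rcases lt_or_gt_of_ne hne with hlt | hlt
        · exact ⟨s, t, hlt, hs.1, ht.2, h⟩
        · exact ⟨t, s, hlt, ht.1, hs.2, h.symm⟩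
  -- If equal blocks continued differently, their suffix would be the right special `v`. But `x v`
  -- is always followed by `x`, and `y v` is excluded inductively, so the period `t - s` propagates.
  have key : ∀ k, ¬ Agree w (s + k) j (m + 1) ∧ Agree w (s + k) (t + k) (m + 1) := by
    intro k
    induction k using Nat.strong_induction_on with
    | _ k ih =>
      constructor
      · by_cases hk : s + k < t
        · have := hwin (s + k - i) (by omega)
          rwa [show i + (s + k - i) = s + k by omega] at this
        · obtain ⟨h1, h2⟩ := ih (k - (t - s)) (by omega)
          rw [show t + (k - (t - s)) = s + k by omega] at h2
          exact fun h => h1 (h2.trans h)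
      · rcases k with _ | k
        · exact hA
        obtain ⟨h1, h2⟩ := ih k (by omega)
        have hlast : w (s + k + 1 + m) = w (t + k + 1 + m) := by
          by_contra hne
          have hv' : Agree w (s + k + 1) (i + 1) m :=
            hw.agree_of_rightSpecial h2.tail hne hv (by
              rwa [show i + 1 + m = i + m + 1 by omega, show j + 1 + m = j + m + 1 by omega,
                hi, hj])
          have h20 : w (s + k) = w (t + k) := h2 0 (by omega)
          by_cases h0 : w (s + k) = w i
          · apply hne
            have e1 := hno' (s + k) h0 hv'
            have e2 := hno' (t + k) (h20 ▸ h0) (h2.tail.symm.trans hv')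
            rw [show s + k + 1 + m = s + k + (m + 1) by omega,
              show t + k + 1 + m = t + k + (m + 1) by omega, e1, e2]
          · exact h1 (Agree.of_succ_left (hw.eq_of_ne (Ne.symm h0) hij) (hv'.trans hv))
        intro r hr
        rcases eq_or_lt_of_le (Nat.lt_succ_iff.1 hr) with rfl | hr'
        · exact hlast
        · exact h2.tail r hr'
  refine hw.not_eventually_periodic (N := s) (p := t - s) (by omega) fun k hk => ?_
  have := (key (k - s)).2 0 (by omega)
  rwa [show s + (k - s) + 0 = k by omega, show t + (k - s) + 0 = k + (t - s) by omega] at this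

/-- A Sturmian word is balanced; `S` counts the occurrences of one of its two letters. -/
theorem IsSturmian.balanced (hw : IsSturmian w) (S x : ℕ → ℤ) (hS : ∀ i, S (i + 1) = S i + x i)
    (hx : ∀ i, x i = 0 ∨ x i = 1) (hxw : ∀ i j, x i = x j ↔ w i = w j)
    (n i j : ℕ) : S (i + n) - S i ≤ S (j + n) - S j + 1 := by
  by_contra! hcon
  have hex : ∃ n, ∃ i j, S (j + n) - S j + 1 < S (i + n) - S i := ⟨n, i, j, hcon⟩
  classical
  clear hcon n i j
  obtain ⟨n, ⟨i, j, hcon⟩, hmin⟩ : ∃ n, (∃ i j, S (j + n) - S j + 1 < S (i + n) - S i) ∧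
      ∀ k < n, ∀ i j, S (i + k) - S i ≤ S (j + k) - S j + 1 :=
    ⟨Nat.find hex, Nat.find_spec hex, fun k hk i j => by
      have := Nat.find_min hex hk
      push Not at this
      exact this i j⟩
  -- A shortest violation is a pair `x v x`, `y v y` with `v` of length `m`.
  obtain ⟨m, rfl⟩ : ∃ m, n = m + 2 := by
    rcases n with _ | _ | m
    · simp at hcon
    · rw [zero_add, hS, hS] at hcon
      rcases hx i with h | h <;> rcases hx j with h' | h' <;> omega
    · exact ⟨m, rfl⟩
  have hdiff : ∀ k, 1 ≤ k → k ≤ m + 1 → S (i + k) - S i = S (j + k) - S j + 1 := by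
    intro k h1 h2
    have e1 := hmin k (by omega) i j
    have e2 := hmin (m + 2 - k) (by omega) (i + k) (j + k)
    rw [show i + k + (m + 2 - k) = i + (m + 2) by omega,
      show j + k + (m + 2 - k) = j + (m + 2) by omega] at e2
    omega
  have hxi : x i = 1 ∧ x j = 0 := by
    have := hdiff 1 le_rfl (by omega)
    rw [hS, hS] at this
    rcases hx i with h | h <;> rcases hx j with h' | h' <;> omega
  have hend : x (i + m + 1) = 1 ∧ x (j + m + 1) = 0 := by
    have := hdiff (m + 1) (by omega) le_rfl
    have e1 := hS (i + m + 1)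
    have e2 := hS (j + m + 1)
    simp only [← add_assoc] at this hcon
    rw [show i + m + 2 = i + m + 1 + 1 by omega, show j + m + 2 = j + m + 1 + 1 by omega] at hcon
    rcases hx (i + m + 1) with h | h <;> rcases hx (j + m + 1) with h' | h' <;> omega
  have hmid : ∀ k, 1 ≤ k → k ≤ m → x (i + k) = x (j + k) := by
    intro k h1 h2
    have e1 := hdiff k h1 (by omega)
    have e2 := hdiff (k + 1) (by omega) (by omega)
    rw [← add_assoc, ← add_assoc, hS, hS] at e2
    omega
  -- Minimality, comparing prefixes of one window with suffixes of the other, forces equal counts in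
  -- prefixes and suffixes of the window at `i`; hence `v` is a palindrome.
  have hsum : ∀ k, k ≤ m → S (i + (k + 1)) - S i = S (i + (m + 2)) - S (i + (m + 1 - k)) := by
    intro k hk
    have e1 := hmin (k + 1) (by omega) i (j + (m + 1 - k))
    have e2 := hmin (k + 1) (by omega) (i + (m + 1 - k)) j
    rw [show j + (m + 1 - k) + (k + 1) = j + (m + 2) by omega] at e1
    rw [show i + (m + 1 - k) + (k + 1) = i + (m + 2) by omega] at e2
    have e3 := hdiff (m + 1 - k) (by omega) (by omega)
    have e4 := hdiff (k + 1) (by omega) (by omega)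
    have e5 := hdiff (m + 1) (by omega) (by omega)
    have e6 := hS (i + (m + 1))
    have e7 := hS (j + (m + 1))
    rw [← add_assoc i, hend.1] at e6
    rw [← add_assoc j, hend.2] at e7
    simp only [add_assoc, Nat.reduceAdd] at e1 e2 e3 e4 e5 e6 e7 ⊢
    omega
  have hpal : ∀ k, 1 ≤ k → k ≤ m → x (i + k) = x (i + (m + 1 - k)) := by
    intro k h1 h2
    have e1 := hsum k h2
    have e2 := hsum (k - 1) (by omega)
    have e3 := hS (i + k)
    have e4 := hS (i + (m + 1 - k))
    rw [show i + (k - 1 + 1) = i + k by omega,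
      show i + (m + 1 - (k - 1)) = i + (m + 1 - k) + 1 by omega] at e2
    rw [← add_assoc] at e1
    omega
  have hij : w i ≠ w j := fun h => by
    have := (hxw i j).2 h
    omega
  have hi : w (i + m + 1) = w i := (hxw _ _).1 (by rw [hend.1, hxi.1])
  have hj : w (j + m + 1) = w j := (hxw _ _).1 (by rw [hend.2, hxi.2])
  have hv : Agree w (i + 1) (j + 1) m := by
    intro k hk
    rw [add_assoc, add_assoc, add_comm 1 k]
    exact (hxw _ _).1 (hmid (k + 1) (by omega) (by omega))
  -- Now `x v` and `y v` are both right special, against uniqueness.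
  obtain ⟨l, hl, hl'⟩ := hw.exists_extension_ne hij hi hj hv
    fun k h1 h2 => (hxw _ _).1 (hpal k h1 h2)
  obtain ⟨r, hr, hr'⟩ := hw.exists_extension_ne hij.symm hj hi hv.symm
    fun k h1 h2 => (hxw _ _).1 (by
      rw [← hmid k h1 h2, hpal k h1 h2, hmid (m + 1 - k) (by omega) (by omega)])
  exact hij (hw.agree_of_rightSpecial hl hl' hr hr' 0 (by omega))

end Factors
-- Irrational slope of a balanced aperiodic sequence.
section Slope

theorem mul_sub_one_le_of_balanced {S : ℕ → ℤ}
    (hbal : ∀ n i j, S (i + n) - S i ≤ S (j + n) - S j + 1) (n i l k : ℕ) :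
    k * (S (i + n) - S i - 1) ≤ S (l + k * n) - S l := by
  induction k with
  | zero => simp
  | succ k ih =>
    have := hbal n i (l + k * n)
    rw [add_mul, one_mul, ← add_assoc]
    push_cast
    linarith

theorem le_mul_add_one_of_balanced {S : ℕ → ℤ}
    (hbal : ∀ n i j, S (i + n) - S i ≤ S (j + n) - S j + 1) (n i l k : ℕ) :
    S (l + k * n) - S l ≤ k * (S (i + n) - S i + 1) := by
  induction k with
  | zero => simp
  | succ k ih =>
    have := hbal n (l + k * n) i
    rw [add_mul, one_mul, ← add_assoc]
    push_cast
    linarith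

/-- Lower bounds from length n and upper bounds from length m are compared over length n * m; any
number separating them serves as slope. -/
theorem exists_slope_of_balanced {S : ℕ → ℤ}
    (hbal : ∀ n i j, S (i + n) - S i ≤ S (j + n) - S j + 1) :
    ∃ a : ℝ, ∀ i n, |((S (i + n) - S i : ℤ) : ℝ) - n * a| ≤ 1 := by
  obtain ⟨a, ha, ha'⟩ := exists_between_of_forall_le
    (s := {r : ℝ | ∃ i n : ℕ, 0 < n ∧ r = ((S (i + n) - S i - 1 : ℤ) : ℝ) / n})
    (t := {r : ℝ | ∃ i n : ℕ, 0 < n ∧ r = ((S (i + n) - S i + 1 : ℤ) : ℝ) / n})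
    ⟨_, 0, 1, one_pos, rfl⟩ ⟨_, 0, 1, one_pos, rfl⟩ (by
      rintro _ ⟨i, n, hn, rfl⟩ _ ⟨j, m, hm, rfl⟩
      have h1 := mul_sub_one_le_of_balanced hbal n i 0 m
      have h2 := le_mul_add_one_of_balanced hbal m j 0 n
      rw [mul_comm m n] at h1
      rw [div_le_div_iff₀ (by exact_mod_cast hn) (by exact_mod_cast hm)]
      have h3 := h1.trans h2
      rw [mul_comm, mul_comm _ (n : ℝ)]
      exact_mod_cast h3)
  refine ⟨a, fun i n => ?_⟩
  rcases Nat.eq_zero_or_pos n with rfl | hn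
  · simp
  have hn' : (0 : ℝ) < n := by exact_mod_cast hn
  have h1 := ha ⟨i, n, hn, rfl⟩
  have h2 := ha' ⟨i, n, hn, rfl⟩
  rw [div_le_iff₀ hn'] at h1
  rw [le_div_iff₀ hn'] at h2
  push_cast at h1 h2 ⊢
  rw [abs_le]
  constructor <;> linarith

/-- The prefix sums of a balanced sequence with rational slope are eventually periodic up to
translation. -/
theorem eventually_eq_of_slope_mul_eq {S : ℕ → ℤ} {a : ℝ}
    (hbal : ∀ n i j, S (i + n) - S i ≤ S (j + n) - S j + 1)
    (ha : ∀ i n, |((S (i + n) - S i : ℤ) : ℝ) - n * a| ≤ 1) {q : ℕ} (hq : 0 < q) {p : ℤ}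
    (hp : (q : ℝ) * a = p) : ∃ N, ∀ i, N ≤ i → S (i + q) - S i = p := by
  have hmul : ∀ i k : ℕ, |S (i + k * q) - S i - k * p| ≤ 1 := by
    intro i k
    have := ha i (k * q)
    push_cast at this
    rw [mul_assoc, hp] at this
    exact_mod_cast this
  -- Each residue class mod `q` has at most one exception: two of the same sign would accumulate a
  -- deviation of 2, and opposite signs violate balance.
  have hfin : {i | S (i + q) - S i ≠ p}.Finite := by
    refine Set.Finite.of_injOn (f := fun i => i % q) (t := (Finset.range q : Set ℕ))
      (fun i _ => by simpa using Nat.mod_lt i hq) ?_ (Finset.finite_toSet _)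
    have aux : ∀ i j, i < j → i % q = j % q → S (i + q) - S i ≠ p → S (j + q) - S j ≠ p →
        False := by
      intro i j hij hmod hi hj
      obtain ⟨k, hk⟩ : ∃ k, j = i + k * q := by
        obtain ⟨k, hk⟩ := (Nat.modEq_iff_dvd' hij.le).1 hmod
        exact ⟨k, by rw [mul_comm]; omega⟩
      obtain ⟨r, rfl⟩ : ∃ r, k = r + 1 := ⟨k - 1, by
        rcases k with _ | k
        · simp at hk; omega
        · simp⟩
      have h1 := hmul i 1
      have h2 := hmul j 1
      have h3 := hmul i (r + 2)
      have h4 := mul_sub_one_le_of_balanced hbal q i (i + q) r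
      have h8 := le_mul_add_one_of_balanced hbal q i (i + q) r
      have h5 := hbal q i j
      have h6 := hbal q j i
      rw [show i + (r + 2) * q = j + q by rw [hk]; ring] at h3
      rw [show i + q + r * q = j by rw [hk]; ring] at h4 h8
      rw [abs_le] at h1 h2 h3
      push_cast at h1 h2 h3
      simp only [one_mul] at h1 h2
      have h7 : ((r : ℤ) + 2) * p = r * p + 2 * p := by ring
      rw [h7] at h3
      have hi' : S (i + q) - S i = p + 1 ∨ S (i + q) - S i = p - 1 := by omega
      rcases hi' with hi' | hi' <;> rw [hi'] at h4 h8
      · rw [add_sub_cancel_right] at h4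
        omega
      · rw [sub_add_cancel] at h8
        omega
    intro i hi j hj h
    rcases lt_trichotomy i j with hlt | heq | hgt
    · exact (aux i j hlt h hi hj).elim
    · exact heq
    · exact (aux j i hgt h.symm hj hi).elim
  obtain ⟨N, hN⟩ := hfin.bddAbove
  refine ⟨N + 1, fun i hi => ?_⟩
  by_contra h
  have := hN h
  omega

theorem IsSturmian.exists_irrational_slope {A : Type*} {w : ℕ → A} (hw : IsSturmian w)
    (S x : ℕ → ℤ) (hS : ∀ i, S (i + 1) = S i + x i)
    (hx : ∀ i, x i = 0 ∨ x i = 1) (hxw : ∀ i j, x i = x j ↔ w i = w j) :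
    ∃ a : ℝ, Irrational a ∧ ∀ i n, |((S (i + n) - S i : ℤ) : ℝ) - n * a| < 1 := by
  have hbal := hw.balanced S x hS hx hxw
  obtain ⟨a, ha⟩ := exists_slope_of_balanced hbal
  have hirr : Irrational a := by
    rintro ⟨r, hr⟩
    obtain ⟨N, hN⟩ := eventually_eq_of_slope_mul_eq hbal ha r.den_pos (p := r.num) (by
      rw [← hr]
      exact_mod_cast r.den_mul_eq_num)
    refine hw.not_eventually_periodic (N := N) r.den_pos fun k hk => (hxw _ _).1 ?_
    have h1 := hN k hk
    have h2 := hN (k + 1) (by omega)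
    rw [show k + 1 + r.den = k + r.den + 1 by omega, hS, hS] at h2
    omega
  refine ⟨a, hirr, fun i n => lt_of_le_of_ne (ha i n) fun h => ?_⟩
  rcases Nat.eq_zero_or_pos n with rfl | hn
  · simp at h
  have h' := hirr.natCast_mul (m := n) (by omega)
  rcases eq_or_eq_neg_of_abs_eq h with h | h
  · exact h' ⟨(S (i + n) - S i - 1 : ℤ), by push_cast at h ⊢; linarith⟩
  · exact h' ⟨(S (i + n) - S i + 1 : ℤ), by push_cast at h ⊢; linarith⟩

end Slope
-- Three gaps for segments of an irrational orbit.
section ThreeGaps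

variable {a : ℝ} {S : ℕ → ℤ} {y : ℕ → ℝ} {O : Set ℕ}

/-- `j` is the first element of `O` after the element `i` of `O`. -/
def IsReturn (O : Set ℕ) (i j : ℕ) : Prop :=
  i < j ∧ i ∈ O ∧ j ∈ O ∧ ∀ k, i < k → k < j → k ∉ O

theorem exists_isReturn (hO : O.Infinite) {i : ℕ} (hi : i ∈ O) : ∃ j, IsReturn O i j := by
  classical
  have hex : ∃ j, i < j ∧ j ∈ O := by
    obtain ⟨j, hj, hij⟩ := hO.exists_gt i
    exact ⟨j, hij, hj⟩
  exact ⟨Nat.find hex, (Nat.find_spec hex).1, hi, (Nat.find_spec hex).2,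
    fun k h1 h2 h3 => Nat.find_min hex h2 ⟨h1, h3⟩⟩

/-- The displacements over equal times differ by `-1`, `0` or `1`. -/
theorem displacement_cases (hy : ∀ i, y i = i * a - S i) (hlt : ∀ i j, |y i - y j| < 1)
    (i j n : ℕ) : y (i + n) - y i = y (j + n) - y j ∨ y (i + n) - y i = y (j + n) - y j + 1 ∨
      y (i + n) - y i = y (j + n) - y j - 1 := by
  have h1 := abs_lt.1 (hlt (i + n) i)
  have h2 := abs_lt.1 (hlt (j + n) j)
  obtain ⟨z, hz⟩ : ∃ z : ℤ, (y (i + n) - y i) - (y (j + n) - y j) = z :=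
    ⟨S i - S (i + n) + S (j + n) - S j, by rw [hy, hy, hy, hy]; push_cast; ring⟩
  have h3 : (z : ℝ) < 2 := by linarith
  have h4 : (-2 : ℝ) < z := by linarith
  have h3' : z < 2 := by exact_mod_cast h3
  have h4' : -2 < z := by exact_mod_cast h4
  obtain rfl | rfl | rfl : z = -1 ∨ z = 0 ∨ z = 1 := by omega
  · right; right; push_cast at hz; linarith
  · left; push_cast at hz; linarith
  · right; left; push_cast at hz; linarith

theorem eq_of_displacement_eq (ha : Irrational a) (hy : ∀ i, y i = i * a - S i) {i j n m : ℕ}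
    (h : y (i + n) - y i = y (j + m) - y j) : n = m := by
  by_contra hne
  have hne' : ((n : ℤ) - m) ≠ 0 := by omega
  apply ha.intCast_mul hne'
  rw [hy, hy, hy, hy] at h
  exact ⟨((S (i + n) - S i - (S (j + m) - S j) : ℤ) : ℚ), by push_cast at h ⊢; linarith⟩

theorem displacement_ne_zero (ha : Irrational a) (hy : ∀ i, y i = i * a - S i) {i n : ℕ}
    (hn : 0 < n) : y (i + n) ≠ y i := by
  intro h
  have := eq_of_displacement_eq ha hy (i := i) (j := i) (n := n) (m := 0) (by simp [h])
  omega

theorem not_constant_displacement (hlt : ∀ i j, |y i - y j| < 1) {i n : ℕ} {d : ℝ} (hd : d ≠ 0)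
    (h : ∀ k : ℕ, y (i + (k + 1) * n) = y (i + k * n) + d) : False := by
  have key : ∀ k : ℕ, y (i + k * n) = y i + k * d := by
    intro k
    induction k with
    | zero => simp
    | succ k ih => rw [h, ih]; push_cast; ring
  obtain ⟨k, hk⟩ := exists_nat_gt (1 / |d|)
  rw [div_lt_iff₀ (abs_pos.2 hd)] at hk
  have := hlt (i + k * n) i
  rw [key, add_sub_cancel_left, abs_mul, Nat.abs_cast] at this
  linarith

/-- If every element of `O` returns to `O` after the same time with the same displacement, the
orbit drifts away. -/
theorem false_of_constant_returns (hlt : ∀ i j, |y i - y j| < 1) (hne : O.Nonempty) {n : ℕ}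
    {d : ℝ} (hd : d ≠ 0) (h : ∀ i ∈ O, i + n ∈ O ∧ y (i + n) = y i + d) : False := by
  obtain ⟨i, hi⟩ := hne
  have hmem : ∀ k : ℕ, i + k * n ∈ O := by
    intro k
    induction k with
    | zero => simpa using hi
    | succ k ih =>
      have := (h _ ih).1
      rwa [add_assoc, ← Nat.succ_mul] at this
  refine not_constant_displacement hlt hd (i := i) (n := n) fun k => ?_
  have := (h _ (hmem k)).2
  rwa [add_assoc, ← Nat.succ_mul] at this

theorem exists_minimal_gap {P : ℕ → ℕ → Prop} (h : ∃ n i, P n i) :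
    ∃ n i, P n i ∧ ∀ m j, P m j → n ≤ m := by
  classical
  obtain ⟨i, hi⟩ := Nat.find_spec h
  exact ⟨Nat.find h, i, hi, fun m j hj => Nat.find_min' h ⟨j, hj⟩⟩

/-- The rise is compared with that of `p`. A larger one would put `i + p` below `i + l`, hence in
`O` too early; a smaller one makes the remaining time `n` a fall inside `O`, which bounds `n` below
by the shortest falling time. -/
theorem return_of_lt (ha : Irrational a) (hy : ∀ i, y i = i * a - S i)
    (hlt : ∀ i j, |y i - y j| < 1) (hlow : ∀ i ∈ O, ∀ j, y j < y i → j ∈ O) {b p : ℕ}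
    (hbp : b + p ∈ O) (hyb : y b < y (b + p))
    (hpmin : ∀ m j, (j ∈ O ∧ j + m ∈ O ∧ y j < y (j + m)) → p ≤ m)
    {i l : ℕ} (hr : IsReturn O i (i + l)) (hil : y i < y (i + l)) :
    (l = p ∧ y (i + l) - y i = y (b + p) - y b) ∨
      ∃ n, l = p + n ∧ 0 < n ∧ b + p + n ∈ O ∧ y (b + p + n) < y (b + p) := by
  obtain ⟨hij, hi, hj, hfirst⟩ := hr
  have hlt' : ∀ i j, y i - y j < 1 := fun i j => (abs_lt.1 (hlt i j)).2
  obtain ⟨n, rfl⟩ := Nat.exists_eq_add_of_le (hpmin l i ⟨hi, hj, hil⟩)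
  have hp : 0 < p := Nat.pos_of_ne_zero (by rintro rfl; simp at hyb)
  rcases Nat.eq_zero_or_pos n with rfl | hn
  · left
    refine ⟨rfl, ?_⟩
    rcases displacement_cases hy hlt i b p with h | h | h
    · exact h
    · linarith [hlt' (i + p) i]
    · linarith [hlt' (b + p) b, show y i < y (i + p) from hil]
  right
  refine ⟨n, rfl, hn, ?_⟩
  rcases lt_trichotomy (y (i + (p + n)) - y i) (y (b + p) - y b) with h | h | h
  · have hlt2 : y (b + p + n) < y (b + p) := by
      rw [add_assoc]
      rcases displacement_cases hy hlt b i (p + n) with h' | h' | h'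
      · linarith
      · linarith [hlt' (b + (p + n)) b]
      · linarith [hlt' b (b + (p + n))]
    exact ⟨hlow _ hbp _ hlt2, hlt2⟩
  · have := eq_of_displacement_eq ha hy h
    omega
  · refine absurd (hlow _ hj (i + p) ?_) (hfirst (i + p) (by omega) (by omega))
    rcases displacement_cases hy hlt i b p with h' | h' | h'
    · linarith
    · linarith [hlt' (i + p) i]
    · linarith

/-- Not the mirror image of `return_of_lt`, since `O` is closed only downwards: here a deeper fall
is excluded because `i + q` already lies below `i`. -/
theorem return_of_gt (ha : Irrational a) (hy : ∀ i, y i = i * a - S i)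
    (hlt : ∀ i j, |y i - y j| < 1) (hlow : ∀ i ∈ O, ∀ j, y j < y i → j ∈ O) {c q : ℕ}
    (hc : c ∈ O) (hyc : y (c + q) < y c)
    (hqmin : ∀ m j, (j ∈ O ∧ j + m ∈ O ∧ y (j + m) < y j) → q ≤ m)
    {i l : ℕ} (hr : IsReturn O i (i + l)) (hil : y (i + l) < y i) :
    (l = q ∧ y (i + l) - y i = y (c + q) - y c) ∨
      ∃ n, l = q + n ∧ 0 < n ∧ c + q + n ∈ O ∧ y (c + q) < y (c + q + n) := by
  obtain ⟨hij, hi, hj, hfirst⟩ := hr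
  have hlt' : ∀ i j, y i - y j < 1 := fun i j => (abs_lt.1 (hlt i j)).2
  obtain ⟨n, rfl⟩ := Nat.exists_eq_add_of_le (hqmin l i ⟨hi, hj, hil⟩)
  have hq : 0 < q := Nat.pos_of_ne_zero (by rintro rfl; simp at hyc)
  rcases Nat.eq_zero_or_pos n with rfl | hn
  · left
    refine ⟨rfl, ?_⟩
    rcases displacement_cases hy hlt i c q with h | h | h
    · exact h
    · linarith [hlt' c (c + q), show y (i + q) < y i from hil]
    · linarith [hlt' i (i + q)]
  right
  refine ⟨n, rfl, hn, ?_⟩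
  rcases lt_trichotomy (y (i + (q + n)) - y i) (y (c + q) - y c) with h | h | h
  · refine absurd (hlow _ hi (i + q) ?_) (hfirst (i + q) (by omega) (by omega))
    rcases displacement_cases hy hlt i c q with h' | h' | h'
    · linarith
    · linarith [hlt' (i + q) (i + (q + n))]
    · linarith
  · have := eq_of_displacement_eq ha hy h
    omega
  · rw [add_assoc]
    rcases displacement_cases hy hlt c i (q + n) with h' | h' | h'
    · exact ⟨hlow _ hc _ (by linarith), by linarith⟩
    · linarith [hlt' (c + (q + n)) (c + q)]
    · linarith [hlt' c (c + (q + n))]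

/-- Three gaps: the returns to an initial segment of an irrational orbit, taken together with
their displacements, take at most three values. -/
theorem three_gaps_lower (ha : Irrational a) (hy : ∀ i, y i = i * a - S i)
    (hlt : ∀ i j, |y i - y j| < 1) (hO : O.Infinite)
    (hlow : ∀ i ∈ O, ∀ j, y j < y i → j ∈ O) :
    ∃ P Q R : ℕ × ℝ, ∀ i l, IsReturn O i (i + l) →
      (l, y (i + l) - y i) = P ∨ (l, y (i + l) - y i) = Q ∨ (l, y (i + l) - y i) = R := by
  have hret : ∀ i ∈ O, ∃ l, 0 < l ∧ IsReturn O i (i + l) := by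
    intro i hi
    obtain ⟨j, hj⟩ := exists_isReturn hO hi
    have := hj.1
    exact ⟨j - i, by omega, by rwa [Nat.add_sub_cancel' this.le]⟩
  have hup : ∃ n i, i ∈ O ∧ i + n ∈ O ∧ y i < y (i + n) := by
    by_contra! hcon
    have hdown : ∃ n i, i ∈ O ∧ i + n ∈ O ∧ y (i + n) < y i := by
      obtain ⟨i, hi⟩ := hO.nonempty
      obtain ⟨l, hl, hr⟩ := hret i hi
      exact ⟨l, i, hi, hr.2.2.1,
        lt_of_le_of_ne (hcon l i hi hr.2.2.1) (displacement_ne_zero ha hy hl)⟩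
    obtain ⟨q, c, ⟨hc, hcq, hyc⟩, hqmin⟩ := exists_minimal_gap hdown
    refine false_of_constant_returns hlt hO.nonempty (n := q) (sub_neg.2 hyc).ne fun i hi => ?_
    obtain ⟨l, hl, hr⟩ := hret i hi
    rcases return_of_gt ha hy hlt hlow hc hyc hqmin hr
      (lt_of_le_of_ne (hcon l i hi hr.2.2.1) (displacement_ne_zero ha hy hl)) with
      ⟨rfl, h⟩ | ⟨n, -, -, h1, h2⟩
    · exact ⟨hr.2.2.1, by linarith⟩
    · exact absurd h2 (hcon n (c + q) hcq h1).not_gt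
  obtain ⟨p, b, ⟨hb, hbp, hyb⟩, hpmin⟩ := exists_minimal_gap hup
  have hdown : ∃ n i, i ∈ O ∧ i + n ∈ O ∧ y (i + n) < y i := by
    by_contra! hcon
    refine false_of_constant_returns hlt hO.nonempty (n := p) (sub_pos.2 hyb).ne' fun i hi => ?_
    obtain ⟨l, hl, hr⟩ := hret i hi
    rcases return_of_lt ha hy hlt hlow hbp hyb hpmin hr
      (lt_of_le_of_ne (hcon l i hi hr.2.2.1) (displacement_ne_zero ha hy hl).symm) with
      ⟨rfl, h⟩ | ⟨n, -, -, h1, h2⟩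
    · exact ⟨hr.2.2.1, by linarith⟩
    · exact absurd h2 (hcon n (b + p) hbp h1).not_gt
  obtain ⟨q, c, ⟨hc, hcq, hyc⟩, hqmin⟩ := exists_minimal_gap hdown
  have hlt' : ∀ i j, y i - y j < 1 := fun i j => (abs_lt.1 (hlt i j)).2
  refine ⟨(p, y (b + p) - y b), (q, y (c + q) - y c),
    (p + q, (y (b + p) - y b) + (y (c + q) - y c)), fun i l hr => ?_⟩
  have hp : 0 < p := Nat.pos_of_ne_zero (by rintro rfl; simp at hyb)
  have hq : 0 < q := Nat.pos_of_ne_zero (by rintro rfl; simp at hyc)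
  have hl : 0 < l := by have := hr.1; omega
  -- Both `i + p` and `i + q` lie above `O`, the latter by wrapping around. So `i + (p + q)` moves
  -- by the sum of the two displacements and lands below `b + p`, in `O`.
  have hlong : p + q ≤ l → l = p + q ∧
      y (i + l) - y i = (y (b + p) - y b) + (y (c + q) - y c) := by
    intro hle
    obtain ⟨-, hi, -, hfirst⟩ := hr
    have hip : i + p ∉ O := hfirst _ (by omega) (by omega)
    have hiq : i + q ∉ O := hfirst _ (by omega) (by omega)
    have hnot : ∀ k ∈ O, ∀ j, j ∉ O → y k ≤ y j :=
      fun k hk j hj => le_of_not_gt fun h => hj (hlow k hk j h)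
    have hyip : y (i + p) - y i = y (b + p) - y b := by
      have := hnot i hi _ hip
      rcases displacement_cases hy hlt i b p with h | h | h
      · exact h
      · linarith [hlt' (i + p) i]
      · linarith [hlt' (b + p) b]
    have hyiq : y (i + q) - y i = y (c + q) - y c + 1 := by
      have := hnot i hi _ hiq
      rcases displacement_cases hy hlt i c q with h | h | h
      · linarith
      · exact h
      · linarith
    have hypq : y (i + (p + q)) - y i = (y (b + p) - y b) + (y (c + q) - y c) := by
      have h1 := hnot c hc _ hip
      rw [← add_assoc]
      rcases displacement_cases hy hlt (i + p) c q with h | h | h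
      · linarith
      · linarith [hlt' (i + p + q) (c + q)]
      · linarith [hlt' (i + q) b, hlt' (i + p) (i + p + q)]
    have hmem : i + (p + q) ∈ O := hlow _ hbp _ (by linarith [hlt' (i + q) b])
    have : ¬ p + q < l := fun h => hfirst (i + (p + q)) (by omega) (by omega) hmem
    obtain rfl : l = p + q := by omega
    exact ⟨rfl, hypq⟩
  simp only [Prod.mk.injEq]
  rcases lt_or_gt_of_ne (displacement_ne_zero ha hy (i := i) hl) with h | h
  · rcases return_of_gt ha hy hlt hlow hc hyc hqmin hr h with h' | ⟨n, rfl, -, h1, h2⟩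
    · exact Or.inr (Or.inl h')
    · have := hpmin n (c + q) ⟨hcq, h1, h2⟩
      exact Or.inr (Or.inr (hlong (by omega)))
  · rcases return_of_lt ha hy hlt hlow hbp hyb hpmin hr h with h' | ⟨n, rfl, -, h1, h2⟩
    · exact Or.inl h'
    · have := hqmin n (b + p) ⟨hbp, h1, h2⟩
      exact Or.inr (Or.inr (hlong (by omega)))

/-- Rising points form an initial segment: if a lower point wrapped while a higher one did not,
their images would be more than 1 apart. Were they finite in number, the displacement would
eventually be a constant fall. -/
theorem three_gaps_of_lt (ha : Irrational a) (hy : ∀ i, y i = i * a - S i)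
    (hlt : ∀ i j, |y i - y j| < 1) {n : ℕ} (hn : 0 < n) (hO : O = {i | y i < y (i + n)}) :
    O.Infinite ∧ ∃ P Q R : ℕ × ℝ, ∀ i l, IsReturn O i (i + l) →
      (l, y (i + l) - y i) = P ∨ (l, y (i + l) - y i) = Q ∨ (l, y (i + l) - y i) = R := by
  have hlt' : ∀ i j, y i - y j < 1 := fun i j => (abs_lt.1 (hlt i j)).2
  have hinf : O.Infinite := by
    intro hfin
    obtain ⟨N, hN⟩ := hfin.bddAbove
    have hneg : ∀ k, y (N + 1 + k + n) < y (N + 1 + k) := by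
      intro k
      refine lt_of_le_of_ne (le_of_not_gt fun h => ?_) (displacement_ne_zero ha hy hn)
      have := hN (by rw [hO]; exact h)
      omega
    have h0 := hneg 0
    refine not_constant_displacement hlt (i := N + 1) (n := n) (sub_neg.2 h0).ne fun k => ?_
    have hk := hneg (k * n)
    have e : N + 1 + (k + 1) * n = N + 1 + k * n + n := by ring
    rw [e]
    rcases displacement_cases hy hlt (N + 1 + k * n) (N + 1 + 0) n with h | h | h
    · linarith
    · linarith [hlt' (N + 1 + 0) (N + 1 + 0 + n)]
    · linarith [hlt' (N + 1 + k * n) (N + 1 + k * n + n)]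
  refine ⟨hinf, three_gaps_lower ha hy hlt hinf fun i hi j hji => ?_⟩
  rw [hO, Set.mem_ofPred_eq] at hi ⊢
  rcases displacement_cases hy hlt j i n with h | h | h
  · linarith
  · linarith
  · linarith [hlt' (i + n) (j + n)]

/-- The reflection `y ↦ -y` turns the final segment into an initial one. -/
theorem three_gaps_of_gt (ha : Irrational a) (hy : ∀ i, y i = i * a - S i)
    (hlt : ∀ i j, |y i - y j| < 1) {n : ℕ} (hn : 0 < n) (hO : O = {i | y (i + n) < y i}) :
    O.Infinite ∧ ∃ P Q R : ℕ × ℝ, ∀ i l, IsReturn O i (i + l) →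
      (l, y (i + l) - y i) = P ∨ (l, y (i + l) - y i) = Q ∨ (l, y (i + l) - y i) = R := by
  obtain ⟨hinf, P, Q, R, h⟩ := three_gaps_of_lt (a := -a) (S := fun i => -S i)
    (y := fun i => -y i) (O := O) ha.neg (fun i => by rw [hy]; push_cast; ring)
    (fun i j => by rw [neg_sub_neg]; exact hlt j i) hn (by simpa using hO)
  refine ⟨hinf, (P.1, -P.2), (Q.1, -Q.2), (R.1, -R.2), fun i l hr => ?_⟩
  rcases h i l hr with h | h | h
  · exact Or.inl (by rw [← h]; simp [neg_add_eq_sub])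
  · exact Or.inr (Or.inl (by rw [← h]; simp [neg_add_eq_sub]))
  · exact Or.inr (Or.inr (by rw [← h]; simp [neg_add_eq_sub]))

end ThreeGaps
-- From orbit returns to abelian returns.
section AbelianReturns

variable {A : Type*} {w : ℕ → A}

theorem abelianClass_block_succ (w : ℕ → A) (i n : ℕ) :
    abelianClass (block w i (n + 1)) = abelianClass (block w i n) + {w (i + n)} := by
  rw [block_succ, abelianClass, abelianClass, ← Multiset.coe_add, Multiset.coe_singleton]

/-- The abelian class of a block of a binary word is determined by its length and by the number
of occurrences of one letter. -/
theorem abelianClass_block {S x : ℕ → ℤ} {a b : A} (hS : ∀ i, S (i + 1) = S i + x i)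
    (ha : ∀ i, w i = a ∧ x i = 1 ∨ w i = b ∧ x i = 0) (i n : ℕ) :
    ∃ c d : ℕ, (c : ℤ) = S (i + n) - S i ∧ c + d = n ∧
      abelianClass (block w i n) = Multiset.replicate c a + Multiset.replicate d b := by
  induction n with
  | zero => exact ⟨0, 0, by simp, rfl, by simp [block, abelianClass]⟩
  | succ n ih =>
    obtain ⟨c, d, hc, hn, h⟩ := ih
    rw [abelianClass_block_succ, h]
    have := hS (i + n)
    rcases ha (i + n) with ⟨h1, h2⟩ | ⟨h1, h2⟩
    · refine ⟨c + 1, d, by rw [← add_assoc]; push_cast; omega, by omega, ?_⟩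
      rw [h1, Multiset.replicate_add, Multiset.replicate_one, add_right_comm]
    · refine ⟨c, d + 1, by rw [← add_assoc]; omega, by omega, ?_⟩
      rw [h1, Multiset.replicate_add, Multiset.replicate_one, add_assoc]

/-- A Sturmian word as a mechanical word: `S` counts the occurrences of one letter in the
prefixes, `a` is its frequency, and `F` gives the abelian class of a block from its length and its
number of occurrences of that letter. -/
theorem IsSturmian.exists_slope_and_class (hw : IsSturmian w) :
    ∃ (S : ℕ → ℤ) (a : ℝ) (F : ℕ → ℤ → Multiset A), Irrational a ∧
      (∀ i n, |((S (i + n) - S i : ℤ) : ℝ) - n * a| < 1) ∧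
      (∀ i n, abelianClass (block w i n) = F n (S (i + n) - S i)) ∧
      ∀ i j n m, abelianClass (block w i n) = abelianClass (block w j m) →
        n = m ∧ S (i + n) - S i = S (j + m) - S j := by
  classical
  obtain ⟨b, hb⟩ := hw.exists_ne
  set x : ℕ → ℤ := fun i => if w i = w 0 then 1 else 0 with hx
  set S : ℕ → ℤ := fun n => ∑ k ∈ Finset.range n, x k with hSdef
  have hS : ∀ i, S (i + 1) = S i + x i := fun i => Finset.sum_range_succ _ _
  have hcases : ∀ i, w i = w 0 ∧ x i = 1 ∨ w i = w b ∧ x i = 0 := by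
    intro i
    by_cases h : w i = w 0
    · exact Or.inl ⟨h, by simp [hx, h]⟩
    · exact Or.inr ⟨hw.eq_of_ne (Ne.symm h) hb.symm, by simp [hx, h]⟩
  have hxw : ∀ i j, x i = x j ↔ w i = w j := by
    intro i j
    rcases hcases i with ⟨h1, h2⟩ | ⟨h1, h2⟩ <;> rcases hcases j with ⟨h3, h4⟩ | ⟨h3, h4⟩ <;>
      simp [h1, h2, h3, h4, hb, hb.symm]
  obtain ⟨a, ha, hlt⟩ := hw.exists_irrational_slope S x hS
    (fun i => (hcases i).symm.imp And.right And.right) hxw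
  -- `toNat` loses nothing, since letter counts are nonnegative.
  refine ⟨S, a, fun n c => Multiset.replicate c.toNat (w 0) +
    Multiset.replicate (n - c.toNat) (w b), ha, hlt, fun i n => ?_, fun i j n m h => ?_⟩
  · obtain ⟨c, d, hc, rfl, h⟩ := abelianClass_block hS hcases i n
    simp [h, ← hc]
  · obtain ⟨c, d, hc, rfl, h1⟩ := abelianClass_block hS hcases i n
    obtain ⟨c', d', hc', rfl, h2⟩ := abelianClass_block hS hcases j m
    rw [h1, h2] at h
    have hcard := congrArg Multiset.card h
    have hcount := congrArg (Multiset.count (w 0)) h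
    simp only [Multiset.card_add, Multiset.card_replicate] at hcard
    simp [Multiset.count_replicate, hb] at hcount
    exact ⟨hcard, by rw [← hc, ← hc', hcount]⟩

theorem semiAbelianReturns_eq (w : ℕ → A) (u : List A) :
    semiAbelianReturns w u =
      {r | ∃ i l, IsReturn {k | AbelianOccursAt w u k} i (i + l) ∧ r = block w i l} := by
  ext r
  constructor
  · rintro ⟨i, j, hij, hi, hj, hfirst, rfl⟩
    exact ⟨i, j - i, by
      rw [Nat.add_sub_cancel' hij.le]
      exact ⟨hij, hi, hj, hfirst⟩, rfl⟩
  · rintro ⟨i, l, ⟨hij, hi, hj, hfirst⟩, rfl⟩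
    exact ⟨i, i + l, hij, hi, hj, hfirst, by rw [Nat.add_sub_cancel_left]⟩

theorem IsSturmian.ncard_abelianReturns (hw : IsSturmian w) {u : List A} (hu : IsFactor w u) :
    (abelianReturns w u).ncard = 2 ∨ (abelianReturns w u).ncard = 3 := by
  obtain ⟨S, a, F, ha, hslope, hF, hFinj⟩ := hw.exists_slope_and_class
  set y : ℕ → ℝ := fun i => i * a - S i with hydef
  have hy : ∀ i, y i = i * a - S i := fun _ => rfl
  have hdisp : ∀ i n, y (i + n) - y i = n * a - ((S (i + n) - S i : ℤ) : ℝ) := by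
    intro i n
    rw [hy, hy]
    push_cast
    ring
  have hlt : ∀ i j, |y i - y j| < 1 := by
    intro i j
    rcases le_total i j with h | h
    · obtain ⟨n, rfl⟩ := Nat.exists_eq_add_of_le h
      rw [abs_sub_comm, hdisp, abs_sub_comm]
      exact hslope i n
    · obtain ⟨n, rfl⟩ := Nat.exists_eq_add_of_le h
      rw [hdisp, abs_sub_comm]
      exact hslope j n
  set O : Set ℕ := {k | AbelianOccursAt w u k} with hOdef
  obtain ⟨i₀, hi₀⟩ := hu
  set n := u.length
  have hmem : ∀ i, i ∈ O ↔ S (i + n) - S i = S (i₀ + n) - S i₀ := by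
    intro i
    rw [hOdef, Set.mem_ofPred_eq, AbelianOccursAt, ← abelianClass_eq_iff]
    constructor
    · intro h
      exact (hFinj i i₀ n n (by rw [hi₀]; exact h)).2
    · intro h
      change abelianClass (block w i n) = _
      rw [hF, h, ← hF, hi₀]
  obtain ⟨hinf, P, Q, R, hgaps⟩ : O.Infinite ∧ ∃ P Q R : ℕ × ℝ, ∀ i l, IsReturn O i (i + l) →
      (l, y (i + l) - y i) = P ∨ (l, y (i + l) - y i) = Q ∨ (l, y (i + l) - y i) = R := by
    -- The empty word has zero displacement, so no sign criterion; it occurs everywhere.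
    rcases Nat.eq_zero_or_pos n with hn | hn
    · have hO : O = Set.univ := Set.eq_univ_of_forall fun i => (hmem i).2 (by simp [hn])
      have hinf : O.Infinite := hO ▸ Set.infinite_univ
      exact ⟨hinf, three_gaps_lower ha hy hlt hinf fun _ _ j _ => hO ▸ Set.mem_univ j⟩
    · have hwin : ∀ i, -1 < y (i + n) - y i ∧ y (i + n) - y i < 1 :=
        fun i => abs_lt.1 (hlt (i + n) i)
      have heq : ∀ i, |(y (i + n) - y i) - (y (i₀ + n) - y i₀)| < 1 → i ∈ O := by
        intro i h
        rw [hdisp, hdisp, sub_sub_sub_cancel_left] at h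
        rw [hmem]
        have h' : |(S (i₀ + n) - S i₀) - (S (i + n) - S i)| < 1 := by exact_mod_cast h
        rw [Int.abs_lt_one_iff] at h'
        omega
      have heq' : ∀ i ∈ O, y (i + n) - y i = y (i₀ + n) - y i₀ := by
        intro i h
        rw [hdisp, hdisp, (hmem i).1 h]
      rcases lt_or_gt_of_ne (displacement_ne_zero ha hy (i := i₀) hn) with h | h
      · refine three_gaps_of_gt ha hy hlt hn (Set.ext fun i => ⟨fun hi => ?_, fun hi => ?_⟩)
        · have := heq' i hi
          change y (i + n) < y i
          linarith
        · rw [Set.mem_ofPred_eq] at hi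
          exact heq i (abs_lt.2 ⟨by linarith [hwin i, hwin i₀], by linarith [hwin i, hwin i₀]⟩)
      · refine three_gaps_of_lt ha hy hlt hn (Set.ext fun i => ⟨fun hi => ?_, fun hi => ?_⟩)
        · have := heq' i hi
          change y i < y (i + n)
          linarith
        · rw [Set.mem_ofPred_eq] at hi
          exact heq i (abs_lt.2 ⟨by linarith [hwin i, hwin i₀], by linarith [hwin i, hwin i₀]⟩)
  have hret : ∀ i l, IsReturn O i (i + l) → abelianClass (block w i l) ∈ abelianReturns w u := by
    intro i l h
    refine ⟨block w i l, ?_, rfl⟩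
    rw [semiAbelianReturns_eq]
    exact ⟨i, l, h, rfl⟩
  -- The floor is taken of an integer: time times slope minus displacement is the letter count.
  have hsub : abelianReturns w u ⊆
      (fun p : ℕ × ℝ => F p.1 ⌊p.1 * a - p.2⌋) '' (({P, Q, R} : Finset (ℕ × ℝ)) : Set (ℕ × ℝ)) := by
    rintro _ ⟨r, hr, rfl⟩
    rw [semiAbelianReturns_eq] at hr
    obtain ⟨i, l, h, rfl⟩ := hr
    refine ⟨(l, y (i + l) - y i), by simpa using hgaps i l h, ?_⟩
    simp only
    rw [hdisp, sub_sub_cancel, Int.floor_intCast, hF]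
  have hfin := (Finset.finite_toSet ({P, Q, R} : Finset (ℕ × ℝ))).image
    (fun p : ℕ × ℝ => F p.1 ⌊p.1 * a - p.2⌋)
  have hle : (abelianReturns w u).ncard ≤ 3 := by
    refine (Set.ncard_le_ncard hsub hfin).trans
      ((Set.ncard_image_le (Finset.finite_toSet _)).trans ?_)
    rw [Set.ncard_coe_finset]
    exact Finset.card_le_three
  have hgt : 1 < (abelianReturns w u).ncard := by
    by_contra! hcon
    rw [Set.ncard_le_one (hfin.subset hsub)] at hcon
    have hex : ∀ i ∈ O, ∃ l, 0 < l ∧ IsReturn O i (i + l) := by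
      intro i hi
      obtain ⟨j, hj⟩ := exists_isReturn hinf hi
      have := hj.1
      exact ⟨j - i, by omega, by rwa [Nat.add_sub_cancel' this.le]⟩
    obtain ⟨j, hj⟩ := hinf.nonempty
    obtain ⟨m, hm, hjm⟩ := hex j hj
    refine false_of_constant_returns hlt hinf.nonempty (n := m)
      (sub_ne_zero.2 (displacement_ne_zero ha hy (i := j) hm)) fun i hi => ?_
    obtain ⟨l, hl, hil⟩ := hex i hi
    obtain ⟨rfl, hc⟩ := hFinj i j l m (hcon _ (hret i l hil) _ (hret j m hjm))
    refine ⟨hil.2.2.1, ?_⟩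
    have e1 := hdisp i l
    have e2 := hdisp j l
    rw [hc] at e1
    linarith
  omega

end AbelianReturns
end InfiniteWord

theorem mainTheorem4 {A : Type*} [Finite A] (w : ℕ → A) (hw : InfiniteWord.IsSturmian w)
    (u : List A) (hu : InfiniteWord.IsFactor w u) :
    (InfiniteWord.abelianReturns w u).ncard = 2 ∨ (InfiniteWord.abelianReturns w u).ncard = 3 :=
  hw.ncard_abelianReturns hu
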